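/- For $A\in\mathbb M_n$ (complex $n\times n$ matrices) let $\Re A=\frac{A+A^*}{2}$ and $W(A)=\{x^*Ax : x\in\mathbb C^n,\ x^*x=1\}$, and for $\alpha\in[0,\frac{\pi}{2})$ let $S_\alpha=\{z\in\mathbb C : \Re z>0,\ |\Im z|\le(\Re z)\tan\alpha\}$. Let $\le$ between Hermitian matrices be the Loewner order. For $v\in[0,1]$ and $A,B\in\mathbb M_n$ with $\Re A,\Re B$ positive definite put $$A\nabla_vB=(1-v)A+vB,\qquad A!_vB=\left((1-v)A^{-1}+vB^{-1}\right)^{-1},$$ $$A\sharp_vB=\frac{\sin v\pi}{\pi}\int_0^\infty s^{v-1}\left(A^{-1}+sB^{-1}\right)^{-1}ds\quad(0<v<1),\qquad A\sharp_0B=A,\quad A\sharp_1B=B.$$ Let $A,B\in\mathbb M_n$ satisfy $W(A),W(B)\subset S_\alpha$ for some $\alpha\in[0,\frac{\pi}{2})$, let $0\le v\le1$, let $0<m\le M$, and put $h=\frac Mm$ and $K(h)=\frac{(h+1)^2}{4h}$. (i) If $mI_n\le\Re(A^{-1})\le MI_n$ and $mI_n\le\Re(B^{-1})\le MI_n$,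 then $$|\det(A\sharp_vB)|\le\sec^{5n}(\alpha)\,K(h)^n\,|\det(A!_vB)|.$$ (ii) If $mI_n\le\Re A\le MI_n$ and $mI_n\le\Re B\le MI_n$, then $$|\det(A\sharp_vB)|\ge\cos^{5n}(\alpha)\,K(h)^{-n}\,|\det(A\nabla_vB)|.$$ -/

import Mathlib

open scoped ComplexOrder ComplexStarModule MatrixOrder

noncomputable section

namespace SectorMatrix

/-- The numerical range `W(A) = {x* A x : x ∈ ℂⁿ, x* x = 1}`. -/
def numericalRange {n : ℕ} (A : Matrix (Fin n) (Fin n) ℂ) : Set ℂ :=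
  {z | ∃ x : Fin n → ℂ, star x ⬝ᵥ x = 1 ∧ z = star x ⬝ᵥ A.mulVec x}

/-- The sector `S_α = {z : Re z > 0, |Im z| ≤ (Re z) tan α}`. -/
def sector (α : ℝ) : Set ℂ :=
  {z | 0 < z.re ∧ |z.im| ≤ z.re * Real.tan α}

/-- The weighted arithmetic mean `A ∇_v B`. -/
def arithMean {n : ℕ} (v : ℝ) (A B : Matrix (Fin n) (Fin n) ℂ) : Matrix (Fin n) (Fin n) ℂ :=
  (1 - v) • A + v • B

/-- The weighted harmonic mean `A !_v B`. -/
def harmMean {n : ℕ} (v : ℝ) (A B : Matrix (Fin n) (Fin n) ℂ) : Matrix (Fin n) (Fin n) ℂ :=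
  ((1 - v) • A⁻¹ + v • B⁻¹)⁻¹

/-- The weighted geometric mean `A ♯_v B` of accretive matrices. For `0 < v < 1` it is
`(sin (v π) / π) ∫₀^∞ s^(v-1) (A⁻¹ + s B⁻¹)⁻¹ ds`, the integral of a matrix-valued function being
taken entrywise. At the end points, where this integral diverges, it is given by the limiting
values `A ♯_0 B = A` and `A ♯_1 B = B`. -/
def geomMean {n : ℕ} (v : ℝ) (A B : Matrix (Fin n) (Fin n) ℂ) : Matrix (Fin n) (Fin n) ℂ :=
  if v = 0 then A
  else if v = 1 then B
  else (Real.sin (v * Real.pi) / Real.pi) •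
    Matrix.of fun i j => ∫ s in Set.Ioi (0 : ℝ), s ^ (v - 1) • (A⁻¹ + s • B⁻¹)⁻¹ i j

/-- The Kantorovich constant `K(h) = (h + 1)² / (4 h)`. -/
def kantorovich (h : ℝ) : ℝ := (h + 1) ^ 2 / (4 * h)

end SectorMatrix

end

/-! The substitution `s = r / (1 - r)` turns the integral for `A ♯_v B` into an average of the
harmonic means `A !_r B` over `r` in `(0, 1)`, with weight the Beta(`v`, `1 - v`) density, a
probability law of mean `v` (`exists_measure_geomMean`). Hence any Loewner bound on `ℜ (A !_r B)`
that is affine in `r` passes to `ℜ (A ♯_v B)` with `r` replaced by `v`.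

Such bounds come from the chord of `x ↦ 1 / x` on `[m, M]`: it lies above the inverse and below
`K(h)` times the inverse (`inv_le_chord_le`). For (i), put `Z_r = (1 - r) A⁻¹ + r B⁻¹`; then `ℜ
(Z_r⁻¹) ≤ (ℜ Z_r)⁻¹ ≤ chord of ℜ Z_r`, which is affine in `r`, and at `r = v` the chord is at most
`K(h) (ℜ Z_v)⁻¹`. For (ii), the chord gives `ℜ Z_r ≤ K(h) (ℜ (A ∇_r B))⁻¹`, so `ℜ (A !_r B) ≥ cos² α
K(h)⁻¹ ℜ (A ∇_r B)`, again affine in `r`.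

Real parts are exchanged for the matrices themselves by `det ℜ Z ≤ |det Z| ≤ secⁿ α det ℜ Z` for
sectorial `Z` (`IsSectorial.norm_det_bounds`). This costs only `sec^{2n} α` in (i) and `cos^{3n} α`
in (ii), better than the stated power `5n`. -/

namespace SectorMatrix

/-! ### The Beta law on the unit interval -/

open MeasureTheory Set

/-- The real Beta integral over the open unit interval. -/
theorem integrableOn_and_integral_beta {a b : ℝ} (ha : 0 < a) (hb : 0 < b) :
    IntegrableOn (fun x : ℝ => x ^ (a - 1) * (1 - x) ^ (b - 1)) (Ioo 0 1) ∧
      ∫ x in Ioo (0 : ℝ) 1, x ^ (a - 1) * (1 - x) ^ (b - 1) =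
        Real.Gamma a * Real.Gamma b / Real.Gamma (a + b) := by
  have hcast : EqOn (fun x : ℝ => (x : ℂ) ^ ((a : ℂ) - 1) * (1 - (x : ℂ)) ^ ((b : ℂ) - 1))
      (fun x : ℝ => ((x ^ (a - 1) * (1 - x) ^ (b - 1) : ℝ) : ℂ)) (Ioo 0 1) := by
    intro x hx
    have h1 : (0 : ℝ) ≤ 1 - x := by linarith [hx.2]
    simp only [Complex.ofReal_mul, Complex.ofReal_cpow hx.1.le, Complex.ofReal_cpow h1]
    push_cast
    rfl
  have hc := Complex.betaIntegral_convergent (u := (a : ℂ)) (v := (b : ℂ)) (by simpa) (by simpa)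
  rw [intervalIntegrable_iff_integrableOn_Ioo_of_le zero_le_one] at hc
  have hc' := (integrableOn_congr_fun hcast measurableSet_Ioo).1 hc
  refine ⟨by simpa [IntegrableOn] using hc'.re, ?_⟩
  have h := Complex.betaIntegral_eq_Gamma_mul_div (a : ℂ) (b : ℂ) (by simpa) (by simpa)
  rw [Complex.betaIntegral, intervalIntegral.integral_of_le zero_le_one,
    integral_Ioc_eq_integral_Ioo, setIntegral_congr_fun measurableSet_Ioo hcast,
    integral_complex_ofReal, ← Complex.ofReal_add, Complex.Gamma_ofReal, Complex.Gamma_ofReal,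
    Complex.Gamma_ofReal] at h
  exact_mod_cast h

/-- The substitution `s = r / (1 - r)` between the half line and the unit interval. -/
theorem integral_Ioi_eq_integral_Ioo_div_one_sub {E : Type*} [NormedAddCommGroup E]
    [NormedSpace ℝ E] (g : ℝ → E) :
    ∫ s in Ioi (0 : ℝ), g s = ∫ r in Ioo (0 : ℝ) 1, (1 / (1 - r) ^ 2) • g (r / (1 - r)) := by
  have himg : (fun r : ℝ => r / (1 - r)) '' Ioo 0 1 = Ioi 0 := by
    ext s
    constructor
    · rintro ⟨r, hr, rfl⟩
      exact div_pos hr.1 (by linarith [hr.2])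
    · intro hs
      have hs' : (0 : ℝ) < s := hs
      -- The inverse substitution is `r = s / (1 + s)`.
      refine ⟨s / (1 + s), ⟨by positivity, by rw [div_lt_one (by positivity)]; linarith⟩, ?_⟩
      simp only
      field_simp
      ring
  have hder : ∀ r ∈ Ioo (0 : ℝ) 1, HasDerivWithinAt (fun r : ℝ => r / (1 - r))
      (1 / (1 - r) ^ 2) (Ioo 0 1) r := by
    intro r hr
    have h1 : 1 - r ≠ 0 := by linarith [hr.2]
    have h := (hasDerivAt_id r).div ((hasDerivAt_id r).const_sub 1) h1
    refine HasDerivAt.hasDerivWithinAt (h.congr_deriv ?_)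
    simp only [id]
    ring
  have hinj : InjOn (fun r : ℝ => r / (1 - r)) (Ioo 0 1) := by
    intro r hr s hs h
    have h1 : 1 - r ≠ 0 := by linarith [hr.2]
    have h2 : 1 - s ≠ 0 := by linarith [hs.2]
    simp only at h
    rw [div_eq_div_iff h1 h2] at h
    linarith
  rw [← himg, integral_image_eq_integral_abs_deriv_smul measurableSet_Ioo hder hinj]
  refine setIntegral_congr_fun measurableSet_Ioo fun r _ => ?_
  rw [abs_of_nonneg (by positivity)]

/-- The density of the Beta distribution with parameters `v` and `1 - v`. -/
noncomputable def betaWeight (v r : ℝ) : ℝ :=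
  Real.sin (v * Real.pi) / Real.pi * (r ^ (v - 1) * (1 - r) ^ (1 - v - 1))

theorem sin_mul_pi_pos {v : ℝ} (hv0 : 0 < v) (hv1 : v < 1) : 0 < Real.sin (v * Real.pi) :=
  Real.sin_pos_of_pos_of_lt_pi (by positivity) (by nlinarith [Real.pi_pos])

theorem betaWeight_nonneg {v r : ℝ} (hv0 : 0 < v) (hv1 : v < 1) (hr : r ∈ Ioo (0 : ℝ) 1) :
    0 ≤ betaWeight v r := by
  have h1 := sin_mul_pi_pos hv0 hv1
  have h2 : 0 ≤ 1 - r := by linarith [hr.2]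
  have h3 := hr.1.le
  have := Real.pi_pos
  unfold betaWeight
  positivity

theorem integrableOn_betaWeight {v : ℝ} (hv0 : 0 < v) (hv1 : v < 1) :
    IntegrableOn (betaWeight v) (Ioo 0 1) :=
  (integrableOn_and_integral_beta hv0 (sub_pos.2 hv1)).1.const_mul _

theorem integral_betaWeight {v : ℝ} (hv0 : 0 < v) (hv1 : v < 1) :
    ∫ r in Ioo (0 : ℝ) 1, betaWeight v r = 1 := by
  have hs := (sin_mul_pi_pos hv0 hv1).ne'
  have hp := Real.pi_pos.ne'
  simp only [betaWeight]
  rw [integral_const_mul, (integrableOn_and_integral_beta hv0 (sub_pos.2 hv1)).2,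
    Real.Gamma_mul_Gamma_one_sub, add_sub_cancel, Real.Gamma_one, mul_comm Real.pi v]
  field_simp

/-- The extra factor `r` raises the first Beta parameter to `v + 1`, and `Γ(v + 1) = v Γ(v)`. This
mean is why affine bounds in `r` average to their value at `v`. -/
theorem integral_betaWeight_mul {v : ℝ} (hv0 : 0 < v) (hv1 : v < 1) :
    ∫ r in Ioo (0 : ℝ) 1, betaWeight v r * r = v := by
  have hs := (sin_mul_pi_pos hv0 hv1).ne'
  have hp := Real.pi_pos.ne'
  have h : ∀ r ∈ Ioo (0 : ℝ) 1, betaWeight v r * r =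
      Real.sin (v * Real.pi) / Real.pi * (r ^ (v + 1 - 1) * (1 - r) ^ (1 - v - 1)) := by
    intro r hr
    rw [betaWeight, show v + 1 - 1 = v - 1 + 1 by ring, Real.rpow_add_one hr.1.ne']
    ring
  rw [setIntegral_congr_fun measurableSet_Ioo h, integral_const_mul,
    (integrableOn_and_integral_beta (by linarith : 0 < v + 1) (sub_pos.2 hv1)).2,
    Real.Gamma_add_one hv0.ne', show v + 1 + (1 - v) = 2 by ring, Real.Gamma_two,
    mul_assoc v, Real.Gamma_mul_Gamma_one_sub, mul_comm Real.pi v]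
  field_simp

/-- The Beta distribution with parameters `v` and `1 - v`. -/
noncomputable def betaLaw (v : ℝ) : Measure ℝ :=
  (volume.restrict (Ioo 0 1)).withDensity fun r => ENNReal.ofReal (betaWeight v r)

theorem measurable_betaWeight (v : ℝ) : Measurable (betaWeight v) := by
  unfold betaWeight
  fun_prop

theorem integral_betaLaw {v : ℝ} (hv0 : 0 < v) (hv1 : v < 1) {E : Type*} [NormedAddCommGroup E]
    [NormedSpace ℝ E] (g : ℝ → E) :
    ∫ r, g r ∂betaLaw v = ∫ r in Ioo (0 : ℝ) 1, betaWeight v r • g r := by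
  rw [betaLaw, integral_withDensity_eq_integral_toReal_smul
    (measurable_betaWeight v).ennreal_ofReal (by simp)]
  refine setIntegral_congr_fun measurableSet_Ioo fun r hr => ?_
  rw [ENNReal.toReal_ofReal (betaWeight_nonneg hv0 hv1 hr)]

theorem isProbabilityMeasure_betaLaw {v : ℝ} (hv0 : 0 < v) (hv1 : v < 1) :
    IsProbabilityMeasure (betaLaw v) := by
  constructor
  rw [betaLaw, withDensity_apply _ MeasurableSet.univ, Measure.restrict_univ,
    ← ofReal_integral_eq_lintegral_ofReal (integrableOn_betaWeight hv0 hv1)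
      ((ae_restrict_iff' measurableSet_Ioo).2 (ae_of_all _ fun r hr =>
        betaWeight_nonneg hv0 hv1 hr)), integral_betaWeight hv0 hv1, ENNReal.ofReal_one]

theorem ae_betaLaw_mem_Icc (v : ℝ) : ∀ᵐ r ∂betaLaw v, r ∈ Icc (0 : ℝ) 1 :=
  (withDensity_absolutelyContinuous _ _).ae_le
    ((ae_restrict_iff' measurableSet_Ioo).2 (ae_of_all _ fun _ hr => Ioo_subset_Icc_self hr))

end SectorMatrix

/-! ### Quadratic forms, congruence and the Kantorovich chord -/

namespace SectorMatrix

open Matrix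

variable {n : ℕ}

/-- The form `x* Z x` associated with a matrix. -/
def form (Z : Matrix (Fin n) (Fin n) ℂ) (x : Fin n → ℂ) : ℂ := star x ⬝ᵥ Z *ᵥ x

theorem form_add (Z W : Matrix (Fin n) (Fin n) ℂ) (x : Fin n → ℂ) :
    form (Z + W) x = form Z x + form W x := by
  simp [form, add_mulVec]

theorem form_sub (Z W : Matrix (Fin n) (Fin n) ℂ) (x : Fin n → ℂ) :
    form (Z - W) x = form Z x - form W x := by
  simp [form, sub_mulVec]

theorem form_smul (c : ℝ) (Z : Matrix (Fin n) (Fin n) ℂ) (x : Fin n → ℂ) :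
    form (c • Z) x = c • form Z x := by
  simp [form, smul_mulVec]

theorem form_star (Z : Matrix (Fin n) (Fin n) ℂ) (x : Fin n → ℂ) :
    form (star Z) x = star (form Z x) := by
  rw [form, form, star_eq_conjTranspose, star_dotProduct, star_mulVec,
    conjTranspose_conjTranspose, dotProduct_mulVec]

theorem form_realPart (Z : Matrix (Fin n) (Fin n) ℂ) (x : Fin n → ℂ) :
    form (ℜ Z : Matrix (Fin n) (Fin n) ℂ) x = ((form Z x).re : ℂ) := by
  rw [realPart_apply_coe, form_smul, form_add, form_star]
  apply Complex.ext
  · simp only [Complex.smul_re, Complex.add_re, Complex.star_def, Complex.conj_re,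
      Complex.ofReal_re, smul_eq_mul]
    ring
  · simp

theorem form_conjTranspose_mul_mul (C D : Matrix (Fin n) (Fin n) ℂ) (x : Fin n → ℂ) :
    form (Cᴴ * D * C) x = form D (C *ᵥ x) := by
  simp only [form, star_mulVec, ← mulVec_mulVec, dotProduct_mulVec, vecMul_vecMul, Matrix.mul_assoc]

theorem form_diagonal (d : Fin n → ℂ) (x : Fin n → ℂ) :
    form (diagonal d) x = ∑ i, d i * (‖x i‖ ^ 2 : ℝ) := by
  simp only [form, dotProduct, mulVec_diagonal, Pi.star_apply]
  refine Finset.sum_congr rfl fun i _ => ?_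
  rw [mul_left_comm, Complex.star_def, Complex.conj_mul', Complex.ofReal_pow]

theorem isHermitian_realPart (Z : Matrix (Fin n) (Fin n) ℂ) :
    (ℜ Z : Matrix (Fin n) (Fin n) ℂ).IsHermitian := (ℜ Z).2

/-- Reduces the Loewner order to scalar inequalities, which can be integrated. -/
theorem le_iff_re_form_le {P Q : Matrix (Fin n) (Fin n) ℂ} (hP : P.IsHermitian)
    (hQ : Q.IsHermitian) : P ≤ Q ↔ ∀ x, (form P x).re ≤ (form Q x).re := by
  rw [le_iff, posSemidef_iff_dotProduct_mulVec]
  have him : ∀ x, (form (Q - P) x).im = 0 := (hQ.sub hP).im_star_dotProduct_mulVec_self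
  constructor
  · rintro ⟨-, h⟩ x
    have h1 : 0 ≤ form (Q - P) x := h x
    have := (Complex.le_def.1 h1).1
    rw [form_sub, Complex.sub_re, Complex.zero_re] at this
    linarith
  · refine fun h => ⟨hQ.sub hP, fun x => ?_⟩
    change 0 ≤ form (Q - P) x
    refine Complex.le_def.2 ⟨?_, (him x).symm⟩
    rw [form_sub, Complex.sub_re, Complex.zero_re]
    linarith [h x]

/-- Simultaneous diagonalization by congruence. -/
theorem exists_congruence_diagonal {H S : Matrix (Fin n) (Fin n) ℂ} (hH : H.PosDef)
    (hS : S.IsHermitian) : ∃ (C : Matrix (Fin n) (Fin n) ℂ) (d : Fin n → ℝ), IsUnit C ∧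
      H = Cᴴ * C ∧ S = Cᴴ * diagonal (fun i => (d i : ℂ)) * C := by
  obtain ⟨D, hD⟩ := CStarAlgebra.nonneg_iff_eq_star_mul_self.1 hH.posSemidef.nonneg
  rw [star_eq_conjTranspose] at hD
  have hDu : IsUnit D.det := by
    have := (isUnit_iff_isUnit_det _).1 hH.isUnit
    rw [hD, det_mul] at this
    exact isUnit_of_mul_isUnit_right this
  have hDu' : IsUnit Dᴴ.det := by rw [det_conjTranspose]; exact hDu.star
  -- With `H = Dᴴ D`, the congruence by `D⁻¹` sends `H` to the identity; a unitary `U` then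
  -- diagonalizes the image of `S` without disturbing it.
  have hT : (D⁻¹ᴴ * S * D⁻¹).IsHermitian := isHermitian_conjTranspose_mul_mul _ hS
  set U : Matrix (Fin n) (Fin n) ℂ := (hT.eigenvectorUnitary : Matrix (Fin n) (Fin n) ℂ) with hU
  have hUU : U * Uᴴ = 1 := mem_unitaryGroup_iff.1 hT.eigenvectorUnitary.2
  have hsp : D⁻¹ᴴ * S * D⁻¹ = U * diagonal (fun i => (hT.eigenvalues i : ℂ)) * Uᴴ :=
    hT.spectral_theorem
  refine ⟨Uᴴ * D, hT.eigenvalues, ?_, ?_, ?_⟩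
  · refine IsUnit.mul ?_ ((isUnit_iff_isUnit_det _).2 hDu)
    exact IsUnit.of_mul_eq_one _ (mul_eq_one_comm.1 hUU)
  · rw [conjTranspose_mul, conjTranspose_conjTranspose, Matrix.mul_assoc, ← Matrix.mul_assoc U,
      hUU, Matrix.one_mul, hD]
  · have : S = Dᴴ * (D⁻¹ᴴ * S * D⁻¹) * D := by
      rw [conjTranspose_nonsing_inv]
      simp only [Matrix.mul_assoc]
      rw [nonsing_inv_mul _ hDu, Matrix.mul_one, ← Matrix.mul_assoc, mul_nonsing_inv _ hDu',
        Matrix.one_mul]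
    refine this.trans ((congrArg (fun T => Dᴴ * T * D) hsp).trans ?_)
    rw [conjTranspose_mul, conjTranspose_conjTranspose]
    simp only [Matrix.mul_assoc]

theorem congr_diagonal_le {C : Matrix (Fin n) (Fin n) ℂ} {d e : Fin n → ℝ}
    (h : ∀ i, d i ≤ e i) : Cᴴ * diagonal (fun i => (d i : ℂ)) * C ≤
      Cᴴ * diagonal (fun i => (e i : ℂ)) * C := by
  rw [le_iff, ← Matrix.sub_mul, ← Matrix.mul_sub, diagonal_sub]
  refine PosSemidef.conjTranspose_mul_mul_same (PosSemidef.diagonal fun i => ?_) C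
  simpa using h i

/-- The vector `C⁻¹ eᵢ` reads off the `i`-th diagonal entry, so that matrix hypotheses become bounds
on the entries. -/
theorem exists_form_eq_diagonal {C : Matrix (Fin n) (Fin n) ℂ} (hC : IsUnit C) (i : Fin n) :
    ∃ x, x ≠ 0 ∧ ∀ d : Fin n → ℂ, form (Cᴴ * diagonal d * C) x = d i := by
  have hC' := (isUnit_iff_isUnit_det _).1 hC
  have hx : C *ᵥ (C⁻¹ *ᵥ Pi.single i 1) = Pi.single i 1 := by
    rw [mulVec_mulVec, mul_nonsing_inv _ hC', one_mulVec]
  refine ⟨C⁻¹ *ᵥ Pi.single i 1, fun h => ?_, fun d => ?_⟩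
  · rw [h, mulVec_zero] at hx
    have := congrFun hx i
    simp at this
  · rw [form_conjTranspose_mul_mul, hx, form_diagonal, Finset.sum_eq_single i]
    · simp
    · intro j _ hj
      simp [hj]
    · simp

theorem congr_diagonal_le_iff {C : Matrix (Fin n) (Fin n) ℂ} (hC : IsUnit C) {d e : Fin n → ℝ} :
    Cᴴ * diagonal (fun i => (d i : ℂ)) * C ≤ Cᴴ * diagonal (fun i => (e i : ℂ)) * C ↔
      ∀ i, d i ≤ e i := by
  refine ⟨fun h i => ?_, congr_diagonal_le⟩
  obtain ⟨x, -, hx⟩ := exists_form_eq_diagonal hC i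
  have h1 := (posSemidef_iff_dotProduct_mulVec.1 (le_iff.1 h)).2 x
  change 0 ≤ form _ x at h1
  rw [form_sub, hx, hx] at h1
  rw [sub_nonneg] at h1
  exact_mod_cast h1

/-- The determinant is monotone in the Loewner order. -/
theorem norm_det_le_of_le {P Q : Matrix (Fin n) (Fin n) ℂ} (hP : 0 ≤ P) (hPQ : P ≤ Q)
    (hQ : Q.PosDef) : ‖P.det‖ ≤ ‖Q.det‖ := by
  obtain ⟨C, d, hC, hQC, hPC⟩ := exists_congruence_diagonal hQ (nonneg_iff_posSemidef.1 hP).1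
  have h0 : ∀ i, 0 ≤ d i := by
    refine (congr_diagonal_le_iff (d := fun _ => 0) hC).1 ?_
    rw [← hPC]
    simpa using hP
  have h1 : ∀ i, d i ≤ 1 := by
    refine (congr_diagonal_le_iff (e := fun _ => 1) hC).1 ?_
    rw [← hPC]
    simpa [← hQC] using hPQ
  rw [hPC, hQC]
  simp only [det_mul, det_diagonal, norm_mul, norm_prod]
  have : ∏ i, ‖(d i : ℂ)‖ ≤ 1 := Finset.prod_le_one (fun _ _ => norm_nonneg _) fun i _ => by
    simpa [abs_of_nonneg (h0 i)] using h1 i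
  calc _ = ‖Cᴴ.det‖ * ‖C.det‖ * ∏ i, ‖(d i : ℂ)‖ := by ring
    _ ≤ _ := mul_le_of_le_one_right (by positivity) this

theorem inv_congr_diagonal {C : Matrix (Fin n) (Fin n) ℂ} (hC : IsUnit C) {d : Fin n → ℂ}
    (hd : ∀ i, d i ≠ 0) :
    (Cᴴ * diagonal d * C)⁻¹ = C⁻¹ * diagonal (fun i => (d i)⁻¹) * C⁻¹ᴴ := by
  have hC' := (isUnit_iff_isUnit_det _).1 hC
  have hCs : IsUnit Cᴴ.det := by rw [det_conjTranspose]; exact hC'.star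
  refine inv_eq_right_inv ?_
  rw [conjTranspose_nonsing_inv]
  calc _ = Cᴴ * diagonal d * (C * C⁻¹) * diagonal (fun i => (d i)⁻¹) * Cᴴ⁻¹ := by
        simp only [Matrix.mul_assoc]
    _ = Cᴴ * (diagonal d * diagonal (fun i => (d i)⁻¹)) * Cᴴ⁻¹ := by
        rw [mul_nonsing_inv _ hC', Matrix.mul_one]
        simp only [Matrix.mul_assoc]
    _ = 1 := by
        rw [diagonal_mul_diagonal]
        simp only [mul_inv_cancel₀ (hd _), diagonal_one, Matrix.mul_one]
        exact mul_nonsing_inv _ hCs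

/-- The Kantorovich inequality between the inverse and its chord. -/
theorem inv_le_chord_le {R : Matrix (Fin n) (Fin n) ℂ} {m M : ℝ} (hm : 0 < m) (hM : 0 < M)
    (hR1 : m • (1 : Matrix (Fin n) (Fin n) ℂ) ≤ R)
    (hR2 : R ≤ M • (1 : Matrix (Fin n) (Fin n) ℂ)) :
    R⁻¹ ≤ (m * M)⁻¹ • ((m + M) • (1 : Matrix (Fin n) (Fin n) ℂ) - R) ∧
      (m * M)⁻¹ • ((m + M) • (1 : Matrix (Fin n) (Fin n) ℂ) - R) ≤ kantorovich (M / m) • R⁻¹ := by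
  have hRh : R.IsHermitian := by
    have h1 := (le_iff.1 hR1).1.add (isHermitian_one.smul (IsSelfAdjoint.all m))
    simpa using h1
  -- Against the identity the congruence `C` is unitary, so both inequalities reduce to the
  -- eigenvalues `d i` in `[m, M]`.
  obtain ⟨C, d, hC, h1, hRC⟩ := exists_congruence_diagonal (PosDef.one (n := Fin n) (R := ℂ)) hRh
  have hsc : ∀ c : ℝ, c • (1 : Matrix (Fin n) (Fin n) ℂ) =
      Cᴴ * diagonal (fun _ => (c : ℂ)) * C := by
    intro c
    rw [← smul_one_eq_diagonal, Matrix.mul_smul, Matrix.mul_one, Matrix.smul_mul, ← h1]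
    ext i j
    simp
  have hd1 : ∀ i, m ≤ d i := by
    rw [hsc, hRC] at hR1
    exact (congr_diagonal_le_iff hC).1 hR1
  have hd2 : ∀ i, d i ≤ M := by
    rw [hsc, hRC] at hR2
    exact (congr_diagonal_le_iff hC).1 hR2
  have hCinv : C⁻¹ = Cᴴ := inv_eq_left_inv h1.symm
  have hinv : R⁻¹ = Cᴴ * diagonal (fun i => (((d i)⁻¹ : ℝ) : ℂ)) * C := by
    rw [hRC, inv_congr_diagonal hC fun i => by
      exact_mod_cast (hm.trans_le (hd1 i)).ne', hCinv, conjTranspose_conjTranspose]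
    simp
  have hsm : ∀ (c : ℝ) (e : Fin n → ℝ), c • (Cᴴ * diagonal (fun i => (e i : ℂ)) * C) =
      Cᴴ * diagonal (fun i => ((c * e i : ℝ) : ℂ)) * C := by
    intro c e
    rw [← Matrix.smul_mul, ← Matrix.mul_smul, ← diagonal_smul]
    congr 3
    ext i
    simp
  have hch : (m + M) • (1 : Matrix (Fin n) (Fin n) ℂ) - R =
      Cᴴ * diagonal (fun i => ((m + M - d i : ℝ) : ℂ)) * C := by
    rw [hsc, hRC, ← Matrix.sub_mul, ← Matrix.mul_sub, diagonal_sub]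
    simp
  rw [hch, hinv, hsm, hsm]
  refine ⟨congr_diagonal_le fun i => ?_, congr_diagonal_le fun i => ?_⟩
  · have h := hm.trans_le (hd1 i)
    have : 0 ≤ (d i - m) * (M - d i) := mul_nonneg (by linarith [hd1 i]) (by linarith [hd2 i])
    rw [inv_mul_eq_div, inv_eq_one_div, div_le_div_iff₀ h (by positivity)]
    nlinarith
  · have h := hm.trans_le (hd1 i)
    have hk : kantorovich (M / m) = (M + m) ^ 2 / (4 * (M * m)) := by
      unfold kantorovich
      field_simp
    rw [hk, inv_mul_eq_div, ← div_eq_mul_inv, div_div, div_le_div_iff₀ (by positivity)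
      (by positivity)]
    -- The square expresses `d (m + M - d) ≤ (m + M)² / 4`, the source of the Kantorovich constant.
    have : 0 ≤ (M + m - 2 * d i) ^ 2 * (m * M) := by positivity
    nlinarith

end SectorMatrix

/-! ### Sectorial matrices -/

namespace SectorMatrix

open Matrix

variable {n : ℕ}

/-- `Z` has its form in the sector `{0 < Re z, |Im z| ≤ t Re z}` away from the zero vector. -/
def IsSectorial (t : ℝ) (Z : Matrix (Fin n) (Fin n) ℂ) : Prop :=
  ∀ x, x ≠ 0 → 0 < (form Z x).re ∧ |(form Z x).im| ≤ t * (form Z x).re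

theorem form_smul_vec (Z : Matrix (Fin n) (Fin n) ℂ) (c : ℝ) (x : Fin n → ℂ) :
    form Z (c • x) = (c ^ 2) • form Z x := by
  simp [form, mulVec_smul, pow_two, mul_assoc]

theorem isSectorial_of_numericalRange_subset {α : ℝ} {Z : Matrix (Fin n) (Fin n) ℂ}
    (h : numericalRange Z ⊆ sector α) : IsSectorial (Real.tan α) Z := by
  intro x hx
  have hN : star x ⬝ᵥ x = ((∑ i, ‖x i‖ ^ 2 : ℝ) : ℂ) := by
    simp [dotProduct, Complex.conj_mul']
  set N : ℝ := ∑ i, ‖x i‖ ^ 2 with hNdef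
  have hN0 : 0 < N := by
    have h1 : 0 < star x ⬝ᵥ x := dotProduct_comm x (star x) ▸ dotProduct_star_self_pos_iff.2 hx
    rw [hN] at h1
    exact_mod_cast h1
  set c : ℝ := (√N)⁻¹ with hc
  have hc2 : c ^ 2 = N⁻¹ := by rw [hc, inv_pow, Real.sq_sqrt hN0.le]
  have hmem : form Z (c • x) ∈ numericalRange Z := by
    refine ⟨c • x, ?_, rfl⟩
    have h1 : star (c • x) ⬝ᵥ (c • x) = c ^ 2 • (star x ⬝ᵥ x) := by
      simp [pow_two, mul_assoc]
    rw [h1, hN, hc2, Complex.real_smul, ← Complex.ofReal_mul, inv_mul_cancel₀ hN0.ne',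
      Complex.ofReal_one]
  obtain ⟨h1, h2⟩ := h hmem
  have hc0 : 0 < c ^ 2 := by rw [hc2]; positivity
  rw [form_smul_vec] at h1 h2
  simp only [Complex.smul_re, Complex.smul_im, smul_eq_mul, abs_mul, abs_of_pos hc0] at h1 h2
  refine ⟨(mul_pos_iff_of_pos_left hc0).1 h1, ?_⟩
  rw [mul_assoc] at h2
  linarith [le_of_mul_le_mul_left h2 hc0]

theorem IsSectorial.posDef {t : ℝ} {Z : Matrix (Fin n) (Fin n) ℂ} (h : IsSectorial t Z) :
    (ℜ Z : Matrix (Fin n) (Fin n) ℂ).PosDef := by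
  refine PosDef.of_dotProduct_mulVec_pos (isHermitian_realPart Z) fun x hx => ?_
  change 0 < form _ x
  rw [form_realPart]
  exact_mod_cast (h x hx).1

theorem IsSectorial.isUnit {t : ℝ} {Z : Matrix (Fin n) (Fin n) ℂ} (h : IsSectorial t Z) :
    IsUnit Z.det := by
  rw [← isUnit_iff_isUnit_det, ← mulVec_injective_iff_isUnit]
  refine (injective_iff_map_eq_zero Z.mulVecLin).2 fun x hx => ?_
  by_contra hne
  have h1 := (h x hne).1
  rw [form, show Z *ᵥ x = 0 from hx] at h1
  simp at h1

/-- With `y = Z⁻¹ x`, the form of `Z⁻¹` at `x` is the conjugate of the form of `Z` at `y`, and the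
sector is symmetric under conjugation. -/
theorem IsSectorial.inv {t : ℝ} {Z : Matrix (Fin n) (Fin n) ℂ} (h : IsSectorial t Z) :
    IsSectorial t Z⁻¹ := by
  intro x hx
  have hZ : Z *ᵥ (Z⁻¹ *ᵥ x) = x := by
    rw [mulVec_mulVec, mul_nonsing_inv _ h.isUnit, one_mulVec]
  have hy : Z⁻¹ *ᵥ x ≠ 0 := by
    intro h0
    rw [h0, mulVec_zero] at hZ
    exact hx hZ.symm
  have hf : form Z⁻¹ x = star (form Z (Z⁻¹ *ᵥ x)) := by
    rw [form, form, hZ, ← star_dotProduct]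
  have := h _ hy
  rw [hf]
  simpa using this

theorem IsSectorial.combination {t r : ℝ} {Z W : Matrix (Fin n) (Fin n) ℂ} (hZ : IsSectorial t Z)
    (hW : IsSectorial t W) (hr : r ∈ Set.Icc (0 : ℝ) 1) :
    IsSectorial t ((1 - r) • Z + r • W) := by
  intro x hx
  obtain ⟨h1, h2⟩ := hZ x hx
  obtain ⟨h3, h4⟩ := hW x hx
  rw [abs_le] at h2 h4
  have hr0 := hr.1
  have hr1 : 0 ≤ 1 - r := by linarith [hr.2]
  rw [form_add, form_smul, form_smul, abs_le]
  simp only [Complex.add_re, Complex.add_im, Complex.smul_re, Complex.smul_im, smul_eq_mul]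
  refine ⟨?_, ?_, ?_⟩
  · rcases hr0.eq_or_lt with h0 | h0
    · rw [← h0]
      simpa using h1
    · exact add_pos_of_nonneg_of_pos (mul_nonneg hr1 h1.le) (mul_pos h0 h3)
  · nlinarith [mul_le_mul_of_nonneg_left h2.1 hr1, mul_le_mul_of_nonneg_left h4.1 hr0]
  · nlinarith [mul_le_mul_of_nonneg_left h2.2 hr1, mul_le_mul_of_nonneg_left h4.2 hr0]

/-- A sectorial matrix is congruent to a diagonal matrix with entries `1 + i d`, `|d| ≤ t`. -/
theorem IsSectorial.exists_congruence {t : ℝ} {Z : Matrix (Fin n) (Fin n) ℂ}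
    (h : IsSectorial t Z) : ∃ (C : Matrix (Fin n) (Fin n) ℂ) (d : Fin n → ℝ), IsUnit C ∧
      (∀ i, |d i| ≤ t) ∧ (ℜ Z : Matrix (Fin n) (Fin n) ℂ) = Cᴴ * C ∧
      Z = Cᴴ * diagonal (fun i => 1 + d i * Complex.I) * C := by
  obtain ⟨C, d, hC, hre, him⟩ := exists_congruence_diagonal h.posDef
    (show (ℑ Z : Matrix (Fin n) (Fin n) ℂ).IsHermitian from (ℑ Z).2)
  have hZ : Z = Cᴴ * diagonal (fun i => 1 + d i * Complex.I) * C := by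
    have h1 : Z = Cᴴ * (1 + Complex.I • diagonal fun i => (d i : ℂ)) * C := by
      conv_lhs => rw [← realPart_add_I_smul_imaginaryPart Z, hre, him]
      simp [Matrix.mul_add, Matrix.add_mul]
    conv_lhs => rw [h1]
    rw [← diagonal_one, ← diagonal_smul, diagonal_add]
    congr 3
    ext i
    simp [mul_comm]
  refine ⟨C, d, hC, fun i => ?_, hre, hZ⟩
  obtain ⟨x, hx, hxd⟩ := exists_form_eq_diagonal hC i
  have h2 := (h x hx).2
  conv at h2 => rw [hZ]
  rw [hxd] at h2
  simpa using h2

theorem realPart_congr_diagonal (C : Matrix (Fin n) (Fin n) ℂ) (d : Fin n → ℂ) :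
    (ℜ (Cᴴ * diagonal d * C) : Matrix (Fin n) (Fin n) ℂ) =
      Cᴴ * diagonal (fun i => ((d i).re : ℂ)) * C := by
  rw [realPart_apply_coe, star_eq_conjTranspose, conjTranspose_mul, conjTranspose_mul,
    conjTranspose_conjTranspose, diagonal_conjTranspose, ← Matrix.mul_assoc, ← Matrix.add_mul,
    ← Matrix.mul_add, diagonal_add, ← Matrix.smul_mul, ← Matrix.mul_smul, ← diagonal_smul]
  congr 3
  ext i
  apply Complex.ext
  · simp
    ring
  · simp

/-- After congruence the entries are `1 + i d` with `|d| ≤ t`, and `Re (1 + i d)⁻¹ = 1 / (1 + d²)`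
lies between `1 / (1 + t²)` and `1`. -/
theorem IsSectorial.realPart_inv_bounds {t : ℝ} {Z : Matrix (Fin n) (Fin n) ℂ}
    (h : IsSectorial t Z) :
    (ℜ Z⁻¹ : Matrix (Fin n) (Fin n) ℂ) ≤ (ℜ Z : Matrix (Fin n) (Fin n) ℂ)⁻¹ ∧
      (1 + t ^ 2)⁻¹ • (ℜ Z : Matrix (Fin n) (Fin n) ℂ)⁻¹ ≤ (ℜ Z⁻¹ : Matrix (Fin n) (Fin n) ℂ) := by
  obtain ⟨C, d, hC, hd, hre, hZ⟩ := h.exists_congruence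
  have hne : ∀ i, (1 + d i * Complex.I : ℂ) ≠ 0 := fun i h0 => by
    have := congrArg Complex.re h0
    simp at this
  have h1 : (ℜ Z : Matrix (Fin n) (Fin n) ℂ)⁻¹ =
      C⁻¹ᴴᴴ * diagonal (fun _ => ((1 : ℝ) : ℂ)) * C⁻¹ᴴ := by
    have := inv_congr_diagonal hC (d := fun _ => 1) (by simp)
    rw [diagonal_one, Matrix.mul_one] at this
    rw [hre, this, conjTranspose_conjTranspose]
    simp
  have h2 : (ℜ Z⁻¹ : Matrix (Fin n) (Fin n) ℂ) =
      C⁻¹ᴴᴴ * diagonal (fun i => (((1 + d i ^ 2)⁻¹ : ℝ) : ℂ)) * C⁻¹ᴴ := by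
    have h3 : Z⁻¹ = C⁻¹ᴴᴴ * diagonal (fun i => (1 + d i * Complex.I : ℂ)⁻¹) * C⁻¹ᴴ := by
      conv_lhs => rw [hZ]
      rw [inv_congr_diagonal hC hne, conjTranspose_conjTranspose]
    rw [h3, realPart_congr_diagonal]
    congr 3
    ext i
    simp [Complex.inv_re, Complex.normSq_apply, pow_two]
  have h4 : (1 + t ^ 2)⁻¹ • (ℜ Z : Matrix (Fin n) (Fin n) ℂ)⁻¹ =
      C⁻¹ᴴᴴ * diagonal (fun _ => (((1 + t ^ 2)⁻¹ : ℝ) : ℂ)) * C⁻¹ᴴ := by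
    rw [h1, ← Matrix.smul_mul, ← Matrix.mul_smul, ← diagonal_smul]
    congr 3
    ext i
    simp
  rw [h4, h2, h1]
  refine ⟨congr_diagonal_le fun i => ?_, congr_diagonal_le fun i => ?_⟩
  · exact inv_le_one_of_one_le₀ (by nlinarith [sq_nonneg (d i)])
  · have := sq_le_sq' (by linarith [abs_le.1 (hd i)]) (abs_le.1 (hd i)).2
    exact inv_anti₀ (by positivity) (by linarith)

/-- Each of the `n` diagonal entries contributes `|1 + i d|`, which lies between `1` and `√(1 +
t²)`. -/
theorem IsSectorial.norm_det_bounds {t : ℝ} {Z : Matrix (Fin n) (Fin n) ℂ}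
    (h : IsSectorial t Z) :
    ‖(ℜ Z : Matrix (Fin n) (Fin n) ℂ).det‖ ≤ ‖Z.det‖ ∧
      ‖Z.det‖ ≤ √(1 + t ^ 2) ^ n * ‖(ℜ Z : Matrix (Fin n) (Fin n) ℂ).det‖ := by
  obtain ⟨C, d, hC, hd, hre, hZ⟩ := h.exists_congruence
  have hnorm : ∀ i, ‖(1 + d i * Complex.I : ℂ)‖ = √(1 + d i ^ 2) := fun i => by
    simpa using Complex.norm_add_mul_I 1 (d i)
  have hdet : ‖Z.det‖ = (∏ i, √(1 + d i ^ 2)) * ‖(Cᴴ * C).det‖ := by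
    conv_lhs => rw [hZ]
    simp only [det_mul, det_diagonal, norm_mul, norm_prod, hnorm]
    ring
  rw [hre, hdet]
  refine ⟨le_mul_of_one_le_left (norm_nonneg _) ?_, mul_le_mul_of_nonneg_right ?_ (norm_nonneg _)⟩
  · calc (1 : ℝ) = ∏ _i : Fin n, 1 := by simp
      _ ≤ _ := Finset.prod_le_prod (fun _ _ => zero_le_one) fun i _ =>
        Real.one_le_sqrt.2 (by nlinarith [sq_nonneg (d i)])
  · calc ∏ i, √(1 + d i ^ 2) ≤ ∏ _i : Fin n, √(1 + t ^ 2) := by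
          refine Finset.prod_le_prod (fun _ _ => Real.sqrt_nonneg _) fun i _ => ?_
          have := sq_le_sq' (by linarith [abs_le.1 (hd i)]) (abs_le.1 (hd i)).2
          exact Real.sqrt_le_sqrt (by linarith)
      _ = _ := by simp

end SectorMatrix

/-! ### The geometric mean as an average of harmonic means -/

namespace SectorMatrix

open Matrix MeasureTheory Set

variable {n : ℕ}

theorem inv_real_smul {Z : Matrix (Fin n) (Fin n) ℂ} (hZ : IsUnit Z.det) {c : ℝ} (hc : c ≠ 0) :
    (c • Z)⁻¹ = c⁻¹ • Z⁻¹ := by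
  refine inv_eq_right_inv ?_
  rw [smul_mul_smul_comm, mul_inv_cancel₀ hc, one_smul, mul_nonsing_inv _ hZ]

theorem exists_measure_geomMean {t v : ℝ} (hv0 : 0 ≤ v) (hv1 : v ≤ 1)
    {A B : Matrix (Fin n) (Fin n) ℂ} (hA : IsSectorial t A) (hB : IsSectorial t B) :
    ∃ μ : Measure ℝ, IsProbabilityMeasure μ ∧ (∀ᵐ r ∂μ, r ∈ Icc (0 : ℝ) 1) ∧ ∫ r, r ∂μ = v ∧
      ∀ i j, geomMean v A B i j = ∫ r, harmMean r A B i j ∂μ := by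
  rcases hv0.eq_or_lt with rfl | hv0
  -- At the end points a Dirac mass replaces the Beta law, so that later arguments need no case
  -- split on `v`.
  · refine ⟨Measure.dirac 0, inferInstance, by simp, by simp, fun i j => ?_⟩
    simp [geomMean, harmMean, nonsing_inv_nonsing_inv _ hA.isUnit]
  rcases hv1.eq_or_lt with rfl | hv1
  · refine ⟨Measure.dirac 1, inferInstance, by simp, by simp, fun i j => ?_⟩
    simp [geomMean, harmMean, nonsing_inv_nonsing_inv _ hB.isUnit]
  refine ⟨betaLaw v, isProbabilityMeasure_betaLaw hv0 hv1, ae_betaLaw_mem_Icc v, ?_,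
    fun i j => ?_⟩
  · rw [integral_betaLaw hv0 hv1]
    exact integral_betaWeight_mul hv0 hv1
  rw [integral_betaLaw hv0 hv1, geomMean, if_neg hv0.ne', if_neg hv1.ne, Matrix.smul_apply,
    Matrix.of_apply, integral_Ioi_eq_integral_Ioo_div_one_sub, ← integral_smul]
  refine setIntegral_congr_fun measurableSet_Ioo fun r hr => ?_
  have h1 : 0 < 1 - r := by linarith [hr.2]
  have h2 : A⁻¹ + (r / (1 - r)) • B⁻¹ = (1 - r)⁻¹ • ((1 - r) • A⁻¹ + r • B⁻¹) := by
    rw [smul_add, smul_smul, smul_smul, inv_mul_cancel₀ h1.ne', one_smul, div_eq_inv_mul]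
  have hu := (hA.inv.combination hB.inv (Ioo_subset_Icc_self hr)).isUnit
  simp only [h2, inv_real_smul hu (inv_ne_zero h1.ne'), inv_inv, Matrix.smul_apply, smul_smul,
    harmMean]
  congr 1
  -- Powers of `1 - r`: `-2` from the Jacobian, `1 - v` from `s ^ (v - 1)`, `1` from the inverse;
  -- their sum `-v` is the Beta exponent.
  rw [betaWeight, Real.div_rpow hr.1.le h1.le, Real.rpow_sub_one h1.ne' v,
    Real.rpow_sub_one h1.ne' (1 - v), Real.rpow_sub h1, Real.rpow_one]
  have := (Real.rpow_pos_of_pos h1 v).ne'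
  field_simp

/-- By Cramer's rule each entry is a polynomial in `r` over a determinant that sectoriality keeps
nonzero on `[0, 1]`. -/
theorem continuousOn_harmMean_apply {t : ℝ} {A B : Matrix (Fin n) (Fin n) ℂ}
    (hA : IsSectorial t A) (hB : IsSectorial t B) (i j : Fin n) :
    ContinuousOn (fun r => harmMean r A B i j) (Icc 0 1) := by
  have hZ : Continuous fun r : ℝ => (1 - r) • A⁻¹ + r • B⁻¹ := by fun_prop
  have h : ∀ r, harmMean r A B i j =
      (((1 - r) • A⁻¹ + r • B⁻¹).det)⁻¹ * ((1 - r) • A⁻¹ + r • B⁻¹).adjugate i j := fun r => by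
    rw [harmMean, inv_def, Ring.inverse_eq_inv', Matrix.smul_apply, smul_eq_mul]
  simp only [h]
  refine ContinuousOn.mul (hZ.matrix_det.continuousOn.inv₀ fun r hr => ?_)
    (hZ.matrix_adjugate.matrix_elem i j).continuousOn
  exact (hA.inv.combination hB.inv hr).isUnit.ne_zero

theorem integrable_of_continuousOn_Icc {E : Type*} [NormedAddCommGroup E] {μ : Measure ℝ}
    [IsFiniteMeasure μ]
    {a b : ℝ} (hμ : ∀ᵐ r ∂μ, r ∈ Icc a b) {f : ℝ → E} (hf : ContinuousOn f (Icc a b)) :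
    Integrable f μ := by
  have := hf.integrableOn_compact (μ := μ) isCompact_Icc
  rwa [IntegrableOn, Measure.restrict_eq_self_of_ae_mem hμ] at this

theorem exists_measure_form_geomMean {t v : ℝ} (hv0 : 0 ≤ v) (hv1 : v ≤ 1)
    {A B : Matrix (Fin n) (Fin n) ℂ} (hA : IsSectorial t A) (hB : IsSectorial t B) :
    ∃ μ : Measure ℝ, IsProbabilityMeasure μ ∧ (∀ᵐ r ∂μ, r ∈ Icc (0 : ℝ) 1) ∧ ∫ r, r ∂μ = v ∧
      ∀ x, Integrable (fun r => form (harmMean r A B) x) μ ∧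
        form (geomMean v A B) x = ∫ r, form (harmMean r A B) x ∂μ := by
  obtain ⟨μ, hμ, hI, hmean, hG⟩ := exists_measure_geomMean hv0 hv1 hA hB
  refine ⟨μ, hμ, hI, hmean, fun x => ?_⟩
  have hij : ∀ i j, Integrable (fun r => star x i * (harmMean r A B i j * x j)) μ := fun i j =>
    ((integrable_of_continuousOn_Icc hI (continuousOn_harmMean_apply hA hB i j)).mul_const
      _).const_mul _
  simp only [form, dotProduct, mulVec, Finset.mul_sum]
  refine ⟨integrable_finsetSum _ fun i _ => integrable_finsetSum _ fun j _ => hij i j, ?_⟩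
  rw [integral_finsetSum _ fun i _ => integrable_finsetSum _ fun j _ => hij i j]
  refine Finset.sum_congr rfl fun i _ => ?_
  rw [integral_finsetSum _ fun j _ => hij i j]
  refine Finset.sum_congr rfl fun j _ => ?_
  rw [integral_const_mul, integral_mul_const, hG]

/-- The sector is a convex cone containing the form of every `A !_r B`, so averaging stays inside
it; the real part stays positive because its integrand is positive almost everywhere. -/
theorem IsSectorial.geomMean {t v : ℝ} (hv0 : 0 ≤ v) (hv1 : v ≤ 1)
    {A B : Matrix (Fin n) (Fin n) ℂ} (hA : IsSectorial t A) (hB : IsSectorial t B) :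
    IsSectorial t (geomMean v A B) := by
  obtain ⟨μ, hμ, hI, -, hG⟩ := exists_measure_form_geomMean hv0 hv1 hA hB
  intro x hx
  obtain ⟨hint, hform⟩ := hG x
  have hsec : ∀ᵐ r ∂μ, 0 < (form (harmMean r A B) x).re ∧
      |(form (harmMean r A B) x).im| ≤ t * (form (harmMean r A B) x).re :=
    hI.mono fun r hr => (hA.inv.combination hB.inv hr).inv x hx
  have hre : (form (SectorMatrix.geomMean v A B) x).re = ∫ r, (form (harmMean r A B) x).re ∂μ := by
    rw [hform]
    exact (integral_re hint).symm
  have him : (form (SectorMatrix.geomMean v A B) x).im = ∫ r, (form (harmMean r A B) x).im ∂μ := by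
    rw [hform]
    exact (integral_im hint).symm
  rw [hre, him]
  constructor
  · rw [integral_pos_iff_support_of_nonneg_ae (hsec.mono fun r hr => hr.1.le) hint.re]
    have h1 : Function.support (fun r => (form (harmMean r A B) x).re) =ᵐ[μ] univ :=
      Filter.eventuallyEq_univ.2 (hsec.mono fun r hr => hr.1.ne')
    rw [measure_congr h1, measure_univ]
    exact one_pos
  · rw [← integral_const_mul]
    refine (abs_integral_le_integral_abs).trans ?_
    exact integral_mono_ae hint.im.abs (hint.re.const_mul t) (hsec.mono fun r hr => hr.2)

theorem integral_re_form_affine {μ : Measure ℝ} [IsProbabilityMeasure μ]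
    (hI : ∀ᵐ r ∂μ, r ∈ Icc (0 : ℝ) 1) (P Q : Matrix (Fin n) (Fin n) ℂ) (x : Fin n → ℂ) :
    Integrable (fun r : ℝ => (form ((1 - r) • P + r • Q) x).re) μ ∧
      ∫ r, (form ((1 - r) • P + r • Q) x).re ∂μ =
        (form ((1 - ∫ r, r ∂μ) • P + (∫ r, r ∂μ) • Q) x).re := by
  have hid : Integrable (fun r : ℝ => r) μ := integrable_of_continuousOn_Icc hI continuousOn_id
  have h1 : Integrable (fun r : ℝ => 1 - r) μ := (integrable_const 1).sub hid
  simp only [form_add, form_smul, Complex.add_re, Complex.smul_re, smul_eq_mul]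
  refine ⟨(h1.mul_const _).add (hid.mul_const _), ?_⟩
  rw [integral_add (h1.mul_const _) (hid.mul_const _), integral_mul_const, integral_mul_const,
    integral_sub (integrable_const 1) hid]
  simp

/-- An affine upper bound for the harmonic means passes to the geometric mean. -/
theorem realPart_geomMean_le {t v : ℝ} (hv0 : 0 ≤ v) (hv1 : v ≤ 1)
    {A B P Q : Matrix (Fin n) (Fin n) ℂ} (hA : IsSectorial t A) (hB : IsSectorial t B)
    (hP : P.IsHermitian) (hQ : Q.IsHermitian)
    (h : ∀ r ∈ Icc (0 : ℝ) 1,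
      (ℜ (harmMean r A B) : Matrix (Fin n) (Fin n) ℂ) ≤ (1 - r) • P + r • Q) :
    (ℜ (geomMean v A B) : Matrix (Fin n) (Fin n) ℂ) ≤ (1 - v) • P + v • Q := by
  have hPQ : ∀ r : ℝ, ((1 - r) • P + r • Q).IsHermitian := fun r =>
    (hP.smul (IsSelfAdjoint.all _)).add (hQ.smul (IsSelfAdjoint.all _))
  obtain ⟨μ, hμ, hI, hmean, hG⟩ := exists_measure_form_geomMean hv0 hv1 hA hB
  rw [le_iff_re_form_le (isHermitian_realPart _) (hPQ v)]
  intro x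
  obtain ⟨hint, hform⟩ := hG x
  obtain ⟨h1, h2⟩ := integral_re_form_affine hI P Q x
  rw [hmean] at h2
  rw [form_realPart, hform, ← h2, Complex.ofReal_re]
  refine (integral_re hint).symm.trans_le (integral_mono_ae hint.re h1 (hI.mono fun r hr => ?_))
  have := (le_iff_re_form_le (isHermitian_realPart _) (hPQ r)).1 (h r hr) x
  rwa [form_realPart, Complex.ofReal_re] at this

/-- An affine lower bound for the harmonic means passes to the geometric mean. -/
theorem le_realPart_geomMean {t v : ℝ} (hv0 : 0 ≤ v) (hv1 : v ≤ 1)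
    {A B P Q : Matrix (Fin n) (Fin n) ℂ} (hA : IsSectorial t A) (hB : IsSectorial t B)
    (hP : P.IsHermitian) (hQ : Q.IsHermitian)
    (h : ∀ r ∈ Icc (0 : ℝ) 1,
      (1 - r) • P + r • Q ≤ (ℜ (harmMean r A B) : Matrix (Fin n) (Fin n) ℂ)) :
    (1 - v) • P + v • Q ≤ (ℜ (geomMean v A B) : Matrix (Fin n) (Fin n) ℂ) := by
  have hPQ : ∀ r : ℝ, ((1 - r) • P + r • Q).IsHermitian := fun r =>
    (hP.smul (IsSelfAdjoint.all _)).add (hQ.smul (IsSelfAdjoint.all _))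
  obtain ⟨μ, hμ, hI, hmean, hG⟩ := exists_measure_form_geomMean hv0 hv1 hA hB
  rw [le_iff_re_form_le (hPQ v) (isHermitian_realPart _)]
  intro x
  obtain ⟨hint, hform⟩ := hG x
  obtain ⟨h1, h2⟩ := integral_re_form_affine hI P Q x
  rw [hmean] at h2
  rw [form_realPart, hform, ← h2, Complex.ofReal_re]
  refine (integral_mono_ae h1 hint.re (hI.mono fun r hr => ?_)).trans_eq (integral_re hint)
  have := (le_iff_re_form_le (hPQ r) (isHermitian_realPart _)).1 (h r hr) x
  rwa [form_realPart, Complex.ofReal_re] at this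

end SectorMatrix

/-! ### Kantorovich bounds for the real part and for the determinant -/

namespace SectorMatrix

open Matrix

variable {n : ℕ}

theorem inv_le_inv_of_posDef_of_le {P Q : Matrix (Fin n) (Fin n) ℂ} (hP : P.PosDef)
    (hPQ : P ≤ Q) : Q⁻¹ ≤ P⁻¹ := by
  have hQ : Q.IsHermitian := by simpa using (le_iff.1 hPQ).1.add hP.1
  obtain ⟨C, d, hC, hPC, hQC⟩ := exists_congruence_diagonal hP hQ
  have hPC' : P = Cᴴ * diagonal (fun _ => ((1 : ℝ) : ℂ)) * C := by simpa using hPC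
  have hd : ∀ i, 1 ≤ d i := by
    rw [hPC', hQC] at hPQ
    exact (congr_diagonal_le_iff hC).1 hPQ
  have h1 : P⁻¹ = C⁻¹ᴴᴴ * diagonal (fun _ => (((1 : ℝ)⁻¹ : ℝ) : ℂ)) * C⁻¹ᴴ := by
    rw [hPC', inv_congr_diagonal hC (by simp), conjTranspose_conjTranspose]
    simp
  have h2 : Q⁻¹ = C⁻¹ᴴᴴ * diagonal (fun i => (((d i)⁻¹ : ℝ) : ℂ)) * C⁻¹ᴴ := by
    rw [hQC, inv_congr_diagonal hC fun i => by
      exact_mod_cast (one_pos.trans_le (hd i)).ne', conjTranspose_conjTranspose]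
    simp
  rw [h1, h2]
  exact congr_diagonal_le fun i => inv_anti₀ one_pos (hd i)

theorem real_smul_le_smul {P Q : Matrix (Fin n) (Fin n) ℂ} (h : P ≤ Q) {c : ℝ} (hc : 0 ≤ c) :
    c • P ≤ c • Q := by
  rw [le_iff, ← smul_sub]
  exact (le_iff.1 h).smul hc

theorem combination_le_combination {P P' Q Q' : Matrix (Fin n) (Fin n) ℂ} (hP : P ≤ P')
    (hQ : Q ≤ Q') {r : ℝ} (hr : r ∈ Set.Icc (0 : ℝ) 1) :
    (1 - r) • P + r • Q ≤ (1 - r) • P' + r • Q' :=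
  add_le_add (real_smul_le_smul hP (by linarith [hr.2])) (real_smul_le_smul hQ hr.1)

theorem realPart_combination (r : ℝ) (P Q : Matrix (Fin n) (Fin n) ℂ) :
    (ℜ ((1 - r) • P + r • Q) : Matrix (Fin n) (Fin n) ℂ) =
      (1 - r) • (ℜ P : Matrix (Fin n) (Fin n) ℂ) + r • (ℜ Q : Matrix (Fin n) (Fin n) ℂ) := by
  simp

theorem norm_det_real_smul {c : ℝ} (hc : 0 ≤ c) (P : Matrix (Fin n) (Fin n) ℂ) :
    ‖(c • P).det‖ = c ^ n * ‖P.det‖ := by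
  have h : c • P = (c : ℂ) • P := by
    ext i j
    simp
  rw [h, det_smul, norm_mul, norm_pow, Complex.norm_real, Real.norm_of_nonneg hc, Fintype.card_fin]

theorem one_le_kantorovich {h : ℝ} (hh : 0 < h) : 1 ≤ kantorovich h := by
  rw [kantorovich, le_div_iff₀ (by positivity)]
  nlinarith [sq_nonneg (h - 1)]

theorem smul_one_le_combination {m r : ℝ} {P Q : Matrix (Fin n) (Fin n) ℂ}
    (hP : m • (1 : Matrix (Fin n) (Fin n) ℂ) ≤ P) (hQ : m • (1 : Matrix (Fin n) (Fin n) ℂ) ≤ Q)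
    (hr : r ∈ Set.Icc (0 : ℝ) 1) : m • (1 : Matrix (Fin n) (Fin n) ℂ) ≤ (1 - r) • P + r • Q := by
  have := combination_le_combination hP hQ hr
  rwa [← add_smul, sub_add_cancel, one_smul] at this

theorem combination_le_smul_one {M r : ℝ} {P Q : Matrix (Fin n) (Fin n) ℂ}
    (hP : P ≤ M • (1 : Matrix (Fin n) (Fin n) ℂ)) (hQ : Q ≤ M • (1 : Matrix (Fin n) (Fin n) ℂ))
    (hr : r ∈ Set.Icc (0 : ℝ) 1) : (1 - r) • P + r • Q ≤ M • (1 : Matrix (Fin n) (Fin n) ℂ) := by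
  have := combination_le_combination hP hQ hr
  rwa [← add_smul, sub_add_cancel, one_smul] at this

/-- The chord is an affine function of its matrix argument, so it commutes with convex combinations.
-/
theorem chord_combination (a b r : ℝ) (P Q : Matrix (Fin n) (Fin n) ℂ) :
    (1 - r) • a • (b • (1 : Matrix (Fin n) (Fin n) ℂ) - P) + r • a • (b • 1 - Q) =
      a • (b • (1 : Matrix (Fin n) (Fin n) ℂ) - ((1 - r) • P + r • Q)) := by
  module

theorem isHermitian_chord (a b : ℝ) {P : Matrix (Fin n) (Fin n) ℂ} (hP : P.IsHermitian) :
    (a • (b • (1 : Matrix (Fin n) (Fin n) ℂ) - P)).IsHermitian :=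
  ((isHermitian_one.smul (IsSelfAdjoint.all b)).sub hP).smul (IsSelfAdjoint.all a)

/-- Upper bound of the real part of the geometric mean. -/
theorem realPart_geomMean_le_kantorovich {t v m M : ℝ} (hv : v ∈ Set.Icc (0 : ℝ) 1)
    {A B : Matrix (Fin n) (Fin n) ℂ} (hA : IsSectorial t A) (hB : IsSectorial t B)
    (hm : 0 < m) (hM : 0 < M)
    (hA1 : m • (1 : Matrix (Fin n) (Fin n) ℂ) ≤ (ℜ A⁻¹ : Matrix (Fin n) (Fin n) ℂ))
    (hA2 : (ℜ A⁻¹ : Matrix (Fin n) (Fin n) ℂ) ≤ M • (1 : Matrix (Fin n) (Fin n) ℂ))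
    (hB1 : m • (1 : Matrix (Fin n) (Fin n) ℂ) ≤ (ℜ B⁻¹ : Matrix (Fin n) (Fin n) ℂ))
    (hB2 : (ℜ B⁻¹ : Matrix (Fin n) (Fin n) ℂ) ≤ M • (1 : Matrix (Fin n) (Fin n) ℂ)) :
    (ℜ (geomMean v A B) : Matrix (Fin n) (Fin n) ℂ) ≤ kantorovich (M / m) •
      (ℜ ((1 - v) • A⁻¹ + v • B⁻¹) : Matrix (Fin n) (Fin n) ℂ)⁻¹ := by
  have hch : ∀ r ∈ Set.Icc (0 : ℝ) 1, _ := fun r hr => inv_le_chord_le hm hM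
    (smul_one_le_combination hA1 hB1 hr) (combination_le_smul_one hA2 hB2 hr)
  have h1 := realPart_geomMean_le hv.1 hv.2 hA hB
    (isHermitian_chord (m * M)⁻¹ (m + M) (isHermitian_realPart A⁻¹))
    (isHermitian_chord (m * M)⁻¹ (m + M) (isHermitian_realPart B⁻¹)) fun r hr => by
      rw [chord_combination]
      refine ((hA.inv.combination hB.inv hr).realPart_inv_bounds.1).trans ?_
      rw [realPart_combination]
      exact (hch r hr).1
  rw [chord_combination] at h1
  rw [realPart_combination]
  -- The two halves of the chord estimate act at different parameters: the lower at every `r` before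
  -- averaging, the upper only at `v`.
  exact h1.trans (hch v hv).2

/-- Lower bound of the real part of the geometric mean. -/
theorem kantorovich_smul_le_realPart_geomMean {t v m M : ℝ} (hv : v ∈ Set.Icc (0 : ℝ) 1)
    {A B : Matrix (Fin n) (Fin n) ℂ} (hA : IsSectorial t A) (hB : IsSectorial t B)
    (hm : 0 < m) (hM : 0 < M)
    (hA1 : m • (1 : Matrix (Fin n) (Fin n) ℂ) ≤ (ℜ A : Matrix (Fin n) (Fin n) ℂ))
    (hA2 : (ℜ A : Matrix (Fin n) (Fin n) ℂ) ≤ M • (1 : Matrix (Fin n) (Fin n) ℂ))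
    (hB1 : m • (1 : Matrix (Fin n) (Fin n) ℂ) ≤ (ℜ B : Matrix (Fin n) (Fin n) ℂ))
    (hB2 : (ℜ B : Matrix (Fin n) (Fin n) ℂ) ≤ M • (1 : Matrix (Fin n) (Fin n) ℂ)) :
    ((1 + t ^ 2)⁻¹ * (kantorovich (M / m))⁻¹) •
      (ℜ (arithMean v A B) : Matrix (Fin n) (Fin n) ℂ) ≤
        (ℜ (geomMean v A B) : Matrix (Fin n) (Fin n) ℂ) := by
  have hK : 0 < kantorovich (M / m) := one_pos.trans_le (one_le_kantorovich (div_pos hM hm))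
  have hcomb : ∀ (c r : ℝ) (P Q : Matrix (Fin n) (Fin n) ℂ),
      (1 - r) • c • P + r • c • Q = c • ((1 - r) • P + r • Q) := fun c r P Q => by module
  have h1 := le_realPart_geomMean hv.1 hv.2 hA hB
    ((isHermitian_realPart A).smul (IsSelfAdjoint.all ((1 + t ^ 2)⁻¹ * (kantorovich (M / m))⁻¹)))
    ((isHermitian_realPart B).smul (IsSelfAdjoint.all ((1 + t ^ 2)⁻¹ * (kantorovich (M / m))⁻¹)))
    fun r hr => by
      have hZ := hA.inv.combination hB.inv hr
      have hR := (hA.combination hB hr).posDef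
      rw [realPart_combination] at hR
      refine le_trans ?_ hZ.realPart_inv_bounds.2
      rw [hcomb, mul_smul]
      refine real_smul_le_smul ?_ (by positivity)
      -- A reverse of operator convexity of the inverse: `(ℜ A)⁻¹` and `(ℜ B)⁻¹` lie below their
      -- chords, whose combination is the chord of the combination, at most `K(h)` times its
      -- inverse.
      have h2 : (ℜ ((1 - r) • A⁻¹ + r • B⁻¹) : Matrix (Fin n) (Fin n) ℂ) ≤
          kantorovich (M / m) • ((1 - r) • (ℜ A : Matrix (Fin n) (Fin n) ℂ) +
            r • (ℜ B : Matrix (Fin n) (Fin n) ℂ))⁻¹ := by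
        rw [realPart_combination]
        refine (combination_le_combination
          (hA.realPart_inv_bounds.1.trans (inv_le_chord_le hm hM hA1 hA2).1)
          (hB.realPart_inv_bounds.1.trans (inv_le_chord_le hm hM hB1 hB2).1) hr).trans ?_
        rw [chord_combination]
        exact (inv_le_chord_le hm hM (smul_one_le_combination hA1 hB1 hr)
          (combination_le_smul_one hA2 hB2 hr)).2
      have h3 := inv_le_inv_of_posDef_of_le hZ.posDef h2
      have hRu := (isUnit_iff_isUnit_det _).1 hR.isUnit
      rwa [inv_real_smul (isUnit_nonsing_inv_det _ hRu) hK.ne',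
        nonsing_inv_nonsing_inv _ hRu] at h3
  rw [hcomb] at h1
  rwa [arithMean, realPart_combination]

/-- One factor `√(1 + t²) ^ n` passes from the geometric mean to its real part, the other from `ℜ
Z_v` back to `Z_v`. -/
theorem norm_det_geomMean_le {t v m M : ℝ} (hv : v ∈ Set.Icc (0 : ℝ) 1)
    {A B : Matrix (Fin n) (Fin n) ℂ} (hA : IsSectorial t A) (hB : IsSectorial t B)
    (hm : 0 < m) (hM : 0 < M)
    (hA1 : m • (1 : Matrix (Fin n) (Fin n) ℂ) ≤ (ℜ A⁻¹ : Matrix (Fin n) (Fin n) ℂ))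
    (hA2 : (ℜ A⁻¹ : Matrix (Fin n) (Fin n) ℂ) ≤ M • (1 : Matrix (Fin n) (Fin n) ℂ))
    (hB1 : m • (1 : Matrix (Fin n) (Fin n) ℂ) ≤ (ℜ B⁻¹ : Matrix (Fin n) (Fin n) ℂ))
    (hB2 : (ℜ B⁻¹ : Matrix (Fin n) (Fin n) ℂ) ≤ M • (1 : Matrix (Fin n) (Fin n) ℂ)) :
    ‖(geomMean v A B).det‖ ≤
      √(1 + t ^ 2) ^ (2 * n) * kantorovich (M / m) ^ n * ‖(harmMean v A B).det‖ := by
  have hK : 0 < kantorovich (M / m) := one_pos.trans_le (one_le_kantorovich (div_pos hM hm))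
  have hG := hA.geomMean hv.1 hv.2 hB
  have hZ := hA.inv.combination hB.inv hv
  have h1 := norm_det_le_of_le hG.posDef.posSemidef.nonneg
    (realPart_geomMean_le_kantorovich hv hA hB hm hM hA1 hA2 hB1 hB2) (hZ.posDef.inv.smul hK)
  rw [norm_det_real_smul hK.le, det_nonsing_inv, Ring.inverse_eq_inv', norm_inv] at h1
  have h2 := hZ.norm_det_bounds.2
  have hZ0 : 0 < ‖((1 - v) • A⁻¹ + v • B⁻¹).det‖ := norm_pos_iff.2 hZ.isUnit.ne_zero
  have hH0 := norm_pos_iff.2 hZ.posDef.det_pos.ne'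
  have h3 : ‖(ℜ ((1 - v) • A⁻¹ + v • B⁻¹) : Matrix (Fin n) (Fin n) ℂ).det‖⁻¹ ≤
      √(1 + t ^ 2) ^ n * ‖((1 - v) • A⁻¹ + v • B⁻¹).det‖⁻¹ := by
    rw [← div_eq_mul_inv, le_div_iff₀ hZ0, inv_mul_le_iff₀ hH0, mul_comm]
    exact h2
  rw [harmMean, det_nonsing_inv, Ring.inverse_eq_inv', norm_inv]
  calc _ ≤ _ := hG.norm_det_bounds.2
    _ ≤ √(1 + t ^ 2) ^ n * (kantorovich (M / m) ^ n *
        (√(1 + t ^ 2) ^ n * ‖((1 - v) • A⁻¹ + v • B⁻¹).det‖⁻¹)) := by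
      refine mul_le_mul_of_nonneg_left (h1.trans ?_) (by positivity)
      exact mul_le_mul_of_nonneg_left h3 (by positivity)
    _ = _ := by ring

/-- Of the exponent `3n`, the scalar `(1 + t²)⁻¹` in the Loewner bound gives `2n`, and passing from
`A ∇_v B` to its real part gives `n`. -/
theorem le_norm_det_geomMean {t v m M : ℝ} (hv : v ∈ Set.Icc (0 : ℝ) 1)
    {A B : Matrix (Fin n) (Fin n) ℂ} (hA : IsSectorial t A) (hB : IsSectorial t B)
    (hm : 0 < m) (hM : 0 < M)
    (hA1 : m • (1 : Matrix (Fin n) (Fin n) ℂ) ≤ (ℜ A : Matrix (Fin n) (Fin n) ℂ))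
    (hA2 : (ℜ A : Matrix (Fin n) (Fin n) ℂ) ≤ M • (1 : Matrix (Fin n) (Fin n) ℂ))
    (hB1 : m • (1 : Matrix (Fin n) (Fin n) ℂ) ≤ (ℜ B : Matrix (Fin n) (Fin n) ℂ))
    (hB2 : (ℜ B : Matrix (Fin n) (Fin n) ℂ) ≤ M • (1 : Matrix (Fin n) (Fin n) ℂ)) :
    (√(1 + t ^ 2))⁻¹ ^ (3 * n) * (kantorovich (M / m))⁻¹ ^ n * ‖(arithMean v A B).det‖ ≤
      ‖(geomMean v A B).det‖ := by
  have hK : 0 < kantorovich (M / m) := one_pos.trans_le (one_le_kantorovich (div_pos hM hm))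
  have hG := hA.geomMean hv.1 hv.2 hB
  have hZ : IsSectorial t (arithMean v A B) := hA.combination hB hv
  have hc : 0 < (1 + t ^ 2)⁻¹ * (kantorovich (M / m))⁻¹ := by positivity
  have h1 := norm_det_le_of_le (hZ.posDef.smul hc).posSemidef.nonneg
    (kantorovich_smul_le_realPart_geomMean hv hA hB hm hM hA1 hA2 hB1 hB2) hG.posDef
  rw [norm_det_real_smul hc.le] at h1
  refine le_trans ?_ (h1.trans hG.norm_det_bounds.1)
  have hs : 0 < √(1 + t ^ 2) := by positivity
  have hs2 : (1 + t ^ 2)⁻¹ = (√(1 + t ^ 2))⁻¹ ^ 2 := by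
    rw [inv_pow, Real.sq_sqrt (by positivity)]
  have h2 : (√(1 + t ^ 2))⁻¹ ^ n * ‖(arithMean v A B).det‖ ≤
      ‖(ℜ (arithMean v A B) : Matrix (Fin n) (Fin n) ℂ).det‖ := by
    rw [inv_pow, inv_mul_le_iff₀ (by positivity)]
    exact hZ.norm_det_bounds.2
  calc _ = ((1 + t ^ 2)⁻¹ * (kantorovich (M / m))⁻¹) ^ n *
        ((√(1 + t ^ 2))⁻¹ ^ n * ‖(arithMean v A B).det‖) := by
        rw [hs2]
        ring
    _ ≤ _ := mul_le_mul_of_nonneg_left h2 (by positivity)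

end SectorMatrix

theorem mainTheorem2 {n : ℕ} (A B : Matrix (Fin n) (Fin n) ℂ) (α v m M : ℝ)
    (hα0 : 0 ≤ α) (hα : α < Real.pi / 2)
    (hA : SectorMatrix.numericalRange A ⊆ SectorMatrix.sector α)
    (hB : SectorMatrix.numericalRange B ⊆ SectorMatrix.sector α)
    (hv0 : 0 ≤ v) (hv1 : v ≤ 1) (hm : 0 < m) (hmM : m ≤ M) :
    (m • (1 : Matrix (Fin n) (Fin n) ℂ) ≤ (ℜ (A⁻¹) : Matrix (Fin n) (Fin n) ℂ) →
      (ℜ (A⁻¹) : Matrix (Fin n) (Fin n) ℂ) ≤ M • (1 : Matrix (Fin n) (Fin n) ℂ) →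
      m • (1 : Matrix (Fin n) (Fin n) ℂ) ≤ (ℜ (B⁻¹) : Matrix (Fin n) (Fin n) ℂ) →
      (ℜ (B⁻¹) : Matrix (Fin n) (Fin n) ℂ) ≤ M • (1 : Matrix (Fin n) (Fin n) ℂ) →
      ‖(SectorMatrix.geomMean v A B).det‖ ≤
        (1 / Real.cos α) ^ (5 * n) * SectorMatrix.kantorovich (M / m) ^ n *
          ‖(SectorMatrix.harmMean v A B).det‖) ∧
    (m • (1 : Matrix (Fin n) (Fin n) ℂ) ≤ (ℜ A : Matrix (Fin n) (Fin n) ℂ) →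
      (ℜ A : Matrix (Fin n) (Fin n) ℂ) ≤ M • (1 : Matrix (Fin n) (Fin n) ℂ) →
      m • (1 : Matrix (Fin n) (Fin n) ℂ) ≤ (ℜ B : Matrix (Fin n) (Fin n) ℂ) →
      (ℜ B : Matrix (Fin n) (Fin n) ℂ) ≤ M • (1 : Matrix (Fin n) (Fin n) ℂ) →
      Real.cos α ^ (5 * n) * (SectorMatrix.kantorovich (M / m))⁻¹ ^ n *
          ‖(SectorMatrix.arithMean v A B).det‖ ≤
        ‖(SectorMatrix.geomMean v A B).det‖) := by
  have hA' := SectorMatrix.isSectorial_of_numericalRange_subset hA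
  have hB' := SectorMatrix.isSectorial_of_numericalRange_subset hB
  have hM := hm.trans_le hmM
  have hcos : 0 < Real.cos α := Real.cos_pos_of_mem_Ioo ⟨by linarith [Real.pi_pos], hα⟩
  have hsec := Real.inv_sqrt_one_add_tan_sq hcos
  have hK : 0 < SectorMatrix.kantorovich (M / m) :=
    one_pos.trans_le (SectorMatrix.one_le_kantorovich (div_pos hM hm))
  refine ⟨fun hA1 hA2 hB1 hB2 => ?_, fun hA1 hA2 hB1 hB2 => ?_⟩
  · refine (SectorMatrix.norm_det_geomMean_le ⟨hv0, hv1⟩ hA' hB' hm hM hA1 hA2 hB1 hB2).trans ?_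
    -- Since `√(1 + tan² α) = sec α ≥ 1`, the exponent `2n` may be raised to `5n`.
    rw [one_div, ← hsec, inv_inv]
    gcongr
    · exact Real.one_le_sqrt.2 (by nlinarith [sq_nonneg (Real.tan α)])
    · norm_num
  · refine le_trans ?_
      (SectorMatrix.le_norm_det_geomMean ⟨hv0, hv1⟩ hA' hB' hm hM hA1 hA2 hB1 hB2)
    rw [hsec]
    gcongr ?_ * _ * _
    exact pow_le_pow_of_le_one hcos.le (Real.cos_le_one α) (by omega)
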